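/- **Theorem (Probabilistic completeness of RRF\*).** *Problem.* Let $d\ge 2$, let $C, C_{\rm obs}\subseteq\mathbb R^d$, let $C_{\rm free}=\overline{C\setminus C_{\rm obs}}$ have finite Lebesgue measure, let $q_{\rm init},q_{\rm target}$ be two configurations, and let $\mathcal L_c$ be an arbitrary cost function on trajectories with values in $[0,\infty)$. Assume that the problem is robustly feasible: for some $\delta>0$ there is a continuous path $\gamma$ from $q_{\rm init}$ to $q_{\rm target}$ such that the closed ball of radius $\delta$ about every point of $\gamma$ is contained in $C_{\rm free}$. *Planner.* Fix a step size $\epsilon>0$, a bound $k\in\mathbb N$, thresholds $\eta,\delta_{\rm threshold}\in\mathbb R$, a concentration $\kappa\ge0$, and kernel parameters $\lambda>0$, $\sigma$, $\beta$ with $\beta\sigma^2\le1$. RRF\* maintains a forest whose vertices are configurations, a list of arms, each attached to a tree, and a counter $n$. Initially the forest consists of two one-vertex trees $T_{\rm init}=\{q_{\rm init}\}$ and $T_{\rm target}=\{q_{\rm target}\}$ with one arm each, and $n=1$. The success probability $\mathbb P(a)\in(0,1]$ of an arm $a$ is an arbitrary fixed function of the configuration at which it started and of its own record of observations (attempted configurations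 and whether the extension succeeded). *Joining* $q$ means: add $q$ as a vertex and, for every tree having a vertex $v$ with $\|v-q\|\le\epsilon$ and $[v,q]\subseteq C_{\rm free}$, add one edge between $q$ and such a vertex: in $T_{\rm init}$ the one that gives the least cost of reaching $q$, in another tree the vertex from which $q$ was extended if there is one and the nearest such vertex otherwise. All these trees thereby merge. If $q$ is then in $T_{\rm init}$, *rewire*: for each vertex $v$ of $T_{\rm init}$ in turn, if $\|v-q\|\le\epsilon$, $[q,v]\subseteq C_{\rm free}$, $v$ is neither $q$ nor an ancestor of $q$, and the trajectory from $q_{\rm init}$ through the tree to $q$ and then straight to $v$ is cheaper than the one through the tree to $v$, then $q$ becomes the parent of $v$. Each pass of the main loop is as follows. 1. A location $q_{\rm local}$ and a potential $p$ are proposed by an arbitrary (possibly random, non-anticipating) technique. If there are fewer than $k$ arms, $p>\delta_{\rm threshold}$ and $q_{\rm local}\in C_{\rm free}$, then $q_{\rm local}$ is joined to the forest; if no tree could be joined, $q_{\rm local}$ is a new local tree and gets a new arm located at $q_{\rm local}$. 2. An arm $a$ is drawn, given the past, with probabilities proportional to the success probabilities of the current arms. 3. If the tree of $a$ is $T_{\rm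 init}$ or $T_{\rm target}$ (or has been merged into one of them), $q_{\rm rand}$ is drawn uniformly from $C_{\rm free}$ given the past and the choice of $a$, $q_{\rm closest}$ is the vertex of that tree closest to $q_{\rm rand}$, and $q_{\rm new}$ is $q_{\rm rand}$ if $\|q_{\rm rand}-q_{\rm closest}\|\le\epsilon$ and otherwise the point of $[q_{\rm closest},q_{\rm rand}]$ at distance $\epsilon$ from $q_{\rm closest}$. Otherwise $q_{\rm closest}$ is the location of $a$ and $q_{\rm new}=q_{\rm closest}+\epsilon x$, where $x\in S^{d-1}$ is drawn, given the past and the choice of $a$, from the proposal density of $a$. This density is the von Mises–Fisher density with concentration $\kappa$ about the previous successful direction of $a$ (the uniform density if there is none), multiplied by $1-\beta k(x,x')$ and renormalised for each direction $x'$ that has failed since that success, with $k(x,x')=\sigma^2\exp(-2\sin^2(\theta/2)/\lambda^2)$, $\theta$ the angle between $x$ and $x'$. 4. If $[q_{\rm closest},q_{\rm new}]\subseteq C_{\rm free}$, then $q_{\rm new}$ is joined to the forest, $T_{\rm init}$ is rewired, $a$ moves to $q_{\rm new}$, and $n$ increases by $1$. 5. The record of $a$ is updated. If its tree is (still) not merged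 with $T_{\rm init}$ or $T_{\rm target}$ and $\mathbb P(a)<\eta$, the arm $a$ is removed. Let $\sigma(i)$ be the planner's output after $i$ passes of the loop: the trajectory through $T_{\rm init}$ from $q_{\rm init}$ to the vertex of $q_{\rm target}$, if that vertex belongs to $T_{\rm init}$ (and nothing otherwise). *Claim.* For every run of RRF\*, $$\lim_{i\to\infty}\mathbb P\big(\sigma(i)\text{ is a trajectory in }C_{\rm free}\text{ from }q_{\rm init}\text{ that reaches }q_{\rm target}\big)=1 .$$ Moreover, when the loop is run as "while $n\le N$", the probability that it stops and that its output is a trajectory in $C_{\rm free}$ from $q_{\rm init}$ that reaches $q_{\rm target}$ tends to $1$ as $N\to\infty$. -/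

import Mathlib

open MeasureTheory ProbabilityTheory Filter Topology
open scoped NNReal unitInterval

noncomputable section

namespace RRF

/-- Configurations live in `ℝ^d` with the Euclidean norm. -/
abbrev Config (d : ℕ) : Type := EuclideanSpace ℝ (Fin d)

/-- A motion planning problem: the configuration space, the obstacle space, the two query
configurations and a cost function `cost` with values in `[0, ∞)` on trajectories. -/
structure Problem (d : ℕ) where
  space : Set (Config d)
  obstacles : Set (Config d)
  qInit : Config d
  qTarget : Config d
  cost : C(I, Config d) → ℝ≥0

/-- The free space is the closure of the set of valid configurations. -/
def Problem.free {d : ℕ} (P : Problem d) : Set (Config d) :=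
  closure (P.space \ P.obstacles)

/-- Some trajectory from `qInit` to `qTarget` keeps a positive distance `δ` to the complement of
the free space. -/
def Problem.RobustlyFeasible {d : ℕ} (P : Problem d) : Prop :=
  ∃ δ : ℝ, 0 < δ ∧ ∃ γ : Path P.qInit P.qTarget, ∀ τ : I, Metric.closedBall (γ τ) δ ⊆ P.free

/-- The parameters of the planner.
* `ε`: step size and connection radius;  `maxArms`: the bound `k` on the number of arms below which
  local trees may be proposed;  `η`: arms of local trees with success probability `< η` are pruned;
  `potentialThreshold`: threshold for the potential of a proposed local tree.
* `κ`: concentration of the von Mises-Fisher prior;  `β`: influence of the kernel;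
  `scale`, `lengthScale`: the parameters `σ` and `λ` of the periodic squared exponential kernel;
  `kernel_le` says that the likelihood factors `1 - β * k` are nonnegative.
* `successProb q log` is the current success probability in `(0, 1]` of an arm that started at `q`
  and has made the observations `log` (most recent first), each being an attempted configuration
  together with the reward (`true` for a successful extension). -/
structure Params (d : ℕ) where
  ε : ℝ
  ε_pos : 0 < ε
  maxArms : ℕ
  η : ℝ
  potentialThreshold : ℝ
  κ : ℝ
  κ_nonneg : 0 ≤ κ
  β : ℝ
  scale : ℝ
  lengthScale : ℝ
  lengthScale_pos : 0 < lengthScale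
  kernel_le : β * scale ^ 2 ≤ 1
  successProb : Config d → List (Config d × Bool) → Set.Ioc (0 : ℝ) 1

/-! ### The local sampler -/

/-- The unit sphere of directions. -/
abbrev Dir (d : ℕ) : Type := Metric.sphere (0 : Config d) 1

/-- Surface measure on the unit sphere. -/
def surface (d : ℕ) : Measure (Dir d) := (volume : Measure (Config d)).toSphere

/-- The periodic squared exponential kernel of period `2π`, evaluated at the angle between two
directions. -/
def kernel {d : ℕ} (A : Params d) (x x' : Config d) : ℝ :=
  A.scale ^ 2 *
    Real.exp (-(2 * Real.sin (Real.pi * InnerProductGeometry.angle x x' / (2 * Real.pi)) ^ 2) /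
      A.lengthScale ^ 2)

/-- The von Mises-Fisher density around the previous successful direction; the uniform density
if there is no previous successful direction. -/
def prior {d : ℕ} (A : Params d) (prev : Option (Config d)) (x : Dir d) : ℝ :=
  let g : Dir d → ℝ := fun y => Real.exp (A.κ * inner ℝ (prev.getD 0) (y : Config d))
  g x / ∫ y, g y ∂(surface d)

/-- The proposal density after the failed directions in the list (most recent first):
each failure multiplies the density by `1 - β * k(x, x')` and renormalises. -/
def proposalDensity {d : ℕ} (A : Params d) (prev : Option (Config d)) :
    List (Config d) → Dir d → ℝ
  | [], x => prior A prev x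
  | x' :: failed, x =>
      proposalDensity A prev failed x * (1 - A.β * kernel A x x') /
        ∫ y : Dir d, proposalDensity A prev failed y * (1 - A.β * kernel A y x') ∂(surface d)

/-- The law of the next local direction. -/
def proposalLaw {d : ℕ} (A : Params d) (prev : Option (Config d)) (failed : List (Config d)) :
    Measure (Config d) :=
  ((surface d).withDensity
    (fun x => ENNReal.ofReal (proposalDensity A prev failed x))).map Subtype.val

/-! ### The state of the planner -/

/-- An arm: the root vertex of its tree, the vertex at which its sampler is located, the previous
successful direction, the directions that failed since then, and all its observations. -/
structure Arm (d : ℕ) where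
  root : ℕ
  loc : ℕ
  prev : Option (Config d)
  failed : List (Config d)
  log : List (Config d × Bool)

/-- A fresh arm for a tree that consists of the vertex `v` only. -/
def Arm.new {d : ℕ} (v : ℕ) : Arm d := ⟨v, v, none, [], []⟩

/-- The state of the planner.  The vertices are `0, …, size - 1`, with `pos v` the configuration
at `v`; the trees are the connected components of `graph`.  The tree rooted at `qInit` is
the component of vertex `0`, the tree rooted at `qTarget` is the component of vertex `1`.
`counter` is the variable `n` of the main loop. -/
structure State (d : ℕ) where
  size : ℕ
  pos : ℕ → Config d
  graph : SimpleGraph ℕ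
  arms : List (Arm d)
  counter : ℕ

/-- Two one-vertex trees with an arm each. -/
def State.initial {d : ℕ} (P : Problem d) : State d where
  size := 2
  pos := fun v => if v = 0 then P.qInit else P.qTarget
  graph := ⊥
  arms := [Arm.new 0, Arm.new 1]
  counter := 1

/-- The tree of this root is one of the two rooted trees. -/
def State.Rooted {d : ℕ} (s : State d) (root : ℕ) : Prop :=
  s.graph.Reachable 0 root ∨ s.graph.Reachable 1 root

/-- The success probability of an arm. -/
def State.armProb {d : ℕ} (A : Params d) (s : State d) (a : Arm d) : ℝ :=
  A.successProb (s.pos a.root) a.log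

/-- The vertex closest to `y` in the tree of `root` (the first one, in case of a tie). -/
def State.closest {d : ℕ} (s : State d) (root : ℕ) (y : Config d) : ℕ :=
  sInf {v | v < s.size ∧ s.graph.Reachable root v ∧
    ∀ w < s.size, s.graph.Reachable root w → dist (s.pos v) y ≤ dist (s.pos w) y}

/-- The configuration reached from `x` by moving towards `y` by at most `ε`. -/
def steer {d : ℕ} (ε : ℝ) (x y : Config d) : Config d :=
  if dist x y ≤ ε then y else x + (ε / dist x y) • (y - x)

/-! ### Trajectories through a tree -/

/-- The piecewise linear trajectory along a walk. -/
def trajectory {d : ℕ} (pos : ℕ → Config d) {G : SimpleGraph ℕ} :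
    {u v : ℕ} → G.Walk u v → Path (pos u) (pos v)
  | _, _, .nil => Path.refl _
  | u, _, .cons (v := w) _ p => (Path.segment (pos u) (pos w)).trans (trajectory pos p)

/-- The path in the tree from the vertex `0` to `v`. -/
def treePath {G : SimpleGraph ℕ} {v : ℕ} (h : G.Reachable 0 v) : G.Path 0 v :=
  open Classical in (Classical.choice h).toPath

/-- The cost of the trajectory in the tree from `qInit` to the vertex `v`. -/
def costTo {d : ℕ} (P : Problem d) (pos : ℕ → Config d) {G : SimpleGraph ℕ} {v : ℕ}
    (h : G.Reachable 0 v) : ℝ≥0 :=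
  P.cost (trajectory pos (treePath h).1).toContinuousMap

/-- The cost of the trajectory in the tree from `qInit` to the vertex `v`, continued straight
to `q`. -/
def costVia {d : ℕ} (P : Problem d) (pos : ℕ → Config d) {G : SimpleGraph ℕ} {v : ℕ}
    (h : G.Reachable 0 v) (q : Config d) : ℝ≥0 :=
  P.cost ((trajectory pos (treePath h).1).trans (Path.segment (pos v) q)).toContinuousMap

/-! ### Joining and rewiring -/

/-- The vertex `v` is within distance `ε` of `q` and the straight connection is free. -/
def State.Connectable {d : ℕ} (P : Problem d) (A : Params d) (s : State d) (q : Config d)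
    (v : ℕ) : Prop :=
  v < s.size ∧ dist (s.pos v) q ≤ A.ε ∧ segment ℝ (s.pos v) q ⊆ P.free

open Classical in
/-- In each tree the new configuration `q` is joined to the vertex with the least key.  In the tree
rooted at `qInit` this is the vertex through which the cost of reaching `q` is least; in
the other trees it is the vertex `q` was extended from if there is one, and the nearest otherwise. -/
def State.linkKey {d : ℕ} (P : Problem d) (s : State d) (origin : Option ℕ) (q : Config d)
    (v : ℕ) : ℝ :=
  if h : s.graph.Reachable 0 v then costVia P s.pos h q
  else if origin = some v then -1
  else dist (s.pos v) q

/-- `v` is the vertex of its tree to which `q` is joined (ties are broken by the order of the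
vertices). -/
def State.IsLink {d : ℕ} (P : Problem d) (A : Params d) (s : State d) (origin : Option ℕ)
    (q : Config d) (v : ℕ) : Prop :=
  s.Connectable P A q v ∧ ∀ w, s.Connectable P A q w → s.graph.Reachable v w →
    s.linkKey P origin q v < s.linkKey P origin q w ∨
      (s.linkKey P origin q v = s.linkKey P origin q w ∧ v ≤ w)

/-- Add `q` as the new vertex `size` and join it to all trees that have a connectable vertex (by one
edge each).  If there is none, the new vertex is a tree of its own. -/
def State.join {d : ℕ} (P : Problem d) (A : Params d) (s : State d) (origin : Option ℕ)
    (q : Config d) : State d :=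
  { s with
    size := s.size + 1
    pos := Function.update s.pos s.size q
    graph := s.graph ⊔
      SimpleGraph.fromEdgeSet {e | ∃ v, s.IsLink P A origin q v ∧ e = s(v, s.size)} }

open Classical in
/-- Consider rerouting the vertex `v` of the tree rooted at `qInit` through the vertex `m`: if `v` is
connectable to the configuration at `m`, is not an ancestor of `m` (nor `m` itself), and has
larger cost than the detour through `m`, then `m` becomes the parent of `v`. -/
def rewireVertex {d : ℕ} (P : Problem d) (A : Params d) (s : State d) (m v : ℕ) : State d :=
  if h : s.graph.Reachable 0 m ∧ s.graph.Reachable 0 v then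
    if s.Connectable P A (s.pos m) v ∧ v ∉ (treePath h.1).1.support ∧
        costVia P s.pos h.1 (s.pos v) < costTo P s.pos h.2 then
      { s with
        graph := s.graph.deleteEdges {s((treePath h.2).1.penultimate, v)} ⊔
          SimpleGraph.edge m v }
    else s
  else s

/-- The rewire procedure for the vertex `m`: all vertices are considered in turn.  (Nothing happens
if `m` is not in the tree rooted at `qInit`.) -/
def rewire {d : ℕ} (P : Problem d) (A : Params d) (s : State d) (m : ℕ) : State d :=
  (List.range s.size).foldl (fun t v => rewireVertex P A t m v) s

/-- Add a new configuration, join it to all trees nearby, and rewire. -/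
def State.insert {d : ℕ} (P : Problem d) (A : Params d) (s : State d) (origin : Option ℕ)
    (q : Config d) : State d :=
  rewire P A (s.join P A origin q) s.size

/-! ### One pass of the main loop -/

open Classical in
/-- The subroutine that may create a new local tree, for a proposed location in the free space and
its potential. -/
def State.propose {d : ℕ} (P : Problem d) (A : Params d) (s : State d)
    (proposal : Config d × ℝ) : State d :=
  if s.arms.length < A.maxArms ∧ A.potentialThreshold < proposal.2 ∧ proposal.1 ∈ P.free then
    let s' := s.insert P A none proposal.1
    if ∃ v, s.Connectable P A proposal.1 v then s'
    else { s' with arms := s'.arms ++ [Arm.new s.size] }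
  else s

open Classical in
/-- The law of the configuration-space sample when arm `a` is picked: a uniformly random free
configuration if its tree is a rooted tree, a direction from the proposal distribution
of the local sampler otherwise. -/
def State.sampleLaw {d : ℕ} (P : Problem d) (A : Params d) (s : State d) (a : Arm d) :
    Measure (Config d) :=
  if s.Rooted a.root then ProbabilityTheory.cond volume P.free
  else proposalLaw A a.prev a.failed

/-- The joint law of the index of the picked arm and the sample: the arm is drawn from the
multinomial distribution with weights the success probabilities, then the sample is drawn. -/
def State.drawLaw {d : ℕ} (P : Problem d) (A : Params d) (s : State d) :
    Measure (ℕ × Config d) :=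
  ∑ i : Fin s.arms.length,
    ENNReal.ofReal
        (s.armProb A s.arms[i] / ∑ j : Fin s.arms.length, s.armProb A s.arms[j]) •
      (s.sampleLaw P A s.arms[i]).map (fun y => ((i : ℕ), y))

open Classical in
/-- Update the `i`-th arm to `a`; remove it instead if it belongs to a local tree and its success
probability is below `η`. -/
def State.updateArm {d : ℕ} (A : Params d) (s : State d) (i : ℕ) (a : Arm d) : State d :=
  if ¬ s.Rooted a.root ∧ s.armProb A a < A.η then { s with arms := s.arms.eraseIdx i }
  else { s with arms := s.arms.set i a }

open Classical in
/-- Attempt to extend the tree of the `i`-th arm with the sample `y` (a free configuration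
for a rooted tree, a direction for a local tree). -/
def State.extend {d : ℕ} (P : Problem d) (A : Params d) (s : State d) (i : ℕ) (y : Config d) :
    State d :=
  match s.arms[i]? with
  | none => s
  | some a =>
    let qClosest : ℕ := if s.Rooted a.root then s.closest a.root y else a.loc
    let qNew : Config d :=
      if s.Rooted a.root then steer A.ε (s.pos qClosest) y else s.pos qClosest + A.ε • y
    if segment ℝ (s.pos qClosest) qNew ⊆ P.free then
      let s' := s.insert P A (some qClosest) qNew
      State.updateArm A { s' with counter := s.counter + 1 } i
        { root := a.root
          loc := s.size
          prev := if s.Rooted a.root then a.prev else some y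
          failed := if s.Rooted a.root then a.failed else []
          log := (qNew, true) :: a.log }
    else
      State.updateArm A s i
        { a with
          failed := if s.Rooted a.root then a.failed else y :: a.failed
          log := (qNew, false) :: a.log }

/-! ### Runs -/

/-- The state after `i` passes of the main loop, where `proposal t` and `draw t` are the proposed
local tree location (with its potential) and the draw (arm index and sample) in pass `t`. -/
def stateAt {d : ℕ} (P : Problem d) (A : Params d) (proposal : ℕ → Config d × ℝ)
    (draw : ℕ → ℕ × Config d) : ℕ → State d
  | 0 => State.initial P
  | t + 1 =>
      ((stateAt P A proposal draw t).propose P A (proposal t)).extend P A (draw t).1 (draw t).2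

/-- The random variables `proposal t`, `draw t` are those of a run of the planner.  Here `ℱ t`
contains all that is known before the draw of pass `t`.  The technique that proposes
locations of local trees is arbitrary; the arm and the sample have the prescribed conditional law
given the past. -/
structure IsRun {d : ℕ} (P : Problem d) (A : Params d) {Ω : Type*} {mΩ : MeasurableSpace Ω}
    (μ : Measure Ω) (ℱ : Filtration ℕ mΩ) (proposal : ℕ → Ω → Config d × ℝ)
    (draw : ℕ → Ω → ℕ × Config d) : Prop where
  measurable_proposal : ∀ t, Measurable[ℱ t] (proposal t)
  measurable_draw : ∀ t, Measurable[ℱ (t + 1)] (draw t)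
  draw_law : ∀ t, ∀ B : Set (ℕ × Config d), MeasurableSet B →
    μ⟦draw t ⁻¹' B | ℱ t⟧ =ᵐ[μ] fun ω =>
      (((stateAt P A (proposal · ω) (draw · ω) t).propose P A (proposal t ω)).drawLaw P A).real B

open Classical in
/-- The output of the planner in a given state: the trajectory in the tree rooted at `qInit` that
leads to the vertex of `qTarget`, if that vertex belongs to the tree. -/
def State.solution {d : ℕ} (s : State d) : Option (C(I, Config d)) :=
  if h : s.graph.Reachable 0 1 then some (trajectory s.pos (treePath h).1).toContinuousMap
  else none

/-- The output is a trajectory in the free space from `qInit` that reaches `qTarget`. -/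
def State.Solved {d : ℕ} (P : Problem d) (s : State d) : Prop :=
  ∃ γ ∈ s.solution, γ 0 = P.qInit ∧ γ 1 = P.qTarget ∧ ∀ τ, γ τ ∈ P.free

/-- The main loop `while n ≤ N` stops after exactly `i` passes. -/
def StopsAt {d : ℕ} (P : Problem d) (A : Params d) (proposal : ℕ → Config d × ℝ)
    (draw : ℕ → ℕ × Config d) (N i : ℕ) : Prop :=
  N < (stateAt P A proposal draw i).counter ∧
    ∀ j < i, (stateAt P A proposal draw j).counter ≤ N

end RRF

end

namespace RRF

/-! ### Graph lemmas -/

/-! The tree of `qInit` alone solves the problem; local trees and rewiring only have to do no harm.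
Vertices are never lost, rewiring keeps connected vertices connected (`reachable_reroute`), and the
arm of `qInit` stays first in the list because it is never pruned and new arms are appended.

Geometry: cover the robust path by a chain of balls of small radius `r`. Once the tree has a vertex
in one ball, a sample drawn for its arm in the next ball is within the step size, is reached by a
free segment and becomes a vertex. At the last ball the vertex of `qTarget` is joined too
(`State.Valid.extend_success`). So it suffices that each ball is hit infinitely often
(`eventually_solved_of_frequently`).

Probability: the success probability of the first arm may decay as its record grows, so there is no
uniform lower bound on its being drawn. But if it were drawn only finitely often, its record would
freeze and, the number of arms being bounded, its conditional probability would stay away from zero;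
the conditional Borel–Cantelli lemma excludes this. The same lemma, read backwards, makes the sum of
these conditional probabilities diverge. Multiplying by the fixed share of a ball in the free space
keeps it divergent, so the ball is hit infinitely often (`IsRun.ae_frequently_mem`). Almost sure
eventual success then yields both limits. -/

theorem reachable_deleteEdges_of_notMem_support {G : SimpleGraph ℕ} {a b u v : ℕ}
    (w : G.Walk a b) (hv : v ∉ w.support) : (G.deleteEdges {s(u, v)}).Reachable a b := by
  by_contra h
  exact hv (w.snd_mem_support_of_mem_edges (w.mem_edges_of_not_reachable_deleteEdges h))

/-- A path visits its endpoint only once, so dropping the last step leaves a walk that avoids `v`.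
-/
theorem reachable_penultimate_deleteEdges {G : SimpleGraph ℕ} {a v : ℕ} {w : G.Walk a v}
    (hw : w.IsPath) (hnil : ¬ w.Nil) :
    (G.deleteEdges {s(w.penultimate, v)}).Reachable a w.penultimate := by
  refine reachable_deleteEdges_of_notMem_support w.dropLast ?_
  rw [SimpleGraph.Walk.support_dropLast hnil]
  have h := hw.support_nodup
  rw [← w.dropLast_support_concat] at h
  intro hv
  exact (List.nodup_append.1 h).2.2 v hv v (by simp) rfl

/-- Replacing the last edge of a path by an edge from a vertex that can be reached without its
endpoint does not disconnect anything. -/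
theorem reachable_reroute {G : SimpleGraph ℕ} {a m v : ℕ} {p : G.Walk a m} {w : G.Walk a v}
    (hw : w.IsPath) (hv : v ∉ p.support) {x y : ℕ} (h : G.Reachable x y) :
    (G.deleteEdges {s(w.penultimate, v)} ⊔ SimpleGraph.edge m v).Reachable x y := by
  set D := G.deleteEdges {s(w.penultimate, v)}
  have hnil : ¬ w.Nil := fun hn => hv (hn.eq ▸ p.start_mem_support)
  have hmv : m ≠ v := fun h => hv (h ▸ p.end_mem_support)
  have hD : D ≤ D ⊔ SimpleGraph.edge m v := le_sup_left
  -- The deleted edge is bypassed: back to `a`, along `p` to `m`, then over the new edge.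
  have h1 : (D ⊔ SimpleGraph.edge m v).Reachable w.penultimate v :=
    ((reachable_penultimate_deleteEdges hw hnil).mono hD).symm.trans
      (((reachable_deleteEdges_of_notMem_support p hv).mono hD).trans
        (SimpleGraph.Adj.reachable (by simp [SimpleGraph.edge_adj, hmv])))
  obtain ⟨q⟩ := h
  induction q with
  | nil => exact SimpleGraph.Reachable.refl _
  | @cons b c e hbc q ih =>
    refine SimpleGraph.Reachable.trans ?_ ih
    by_cases hs : s(b, c) = s(w.penultimate, v)
    · rcases Sym2.eq_iff.1 hs with ⟨rfl, rfl⟩ | ⟨rfl, rfl⟩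
      exacts [h1, h1.symm]
    · exact SimpleGraph.Adj.reachable (hD (by
        rw [SimpleGraph.deleteEdges_adj]; exact ⟨hbc, hs⟩))

/-! ### Trajectories -/

theorem trajectory_mem {d : ℕ} {pos : ℕ → Config d} {S : Set (Config d)} {G : SimpleGraph ℕ}
    (hG : ∀ u v, G.Adj u v → segment ℝ (pos u) (pos v) ⊆ S) :
    ∀ {u v : ℕ} (w : G.Walk u v), pos u ∈ S → Set.range (trajectory pos w) ⊆ S
  | _, _, .nil, hu => by
      rintro _ ⟨τ, rfl⟩
      simpa [trajectory] using hu
  | u, _, .cons (v := c) h p, hu => by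
      rw [trajectory, Path.trans_range]
      refine Set.union_subset ?_ (trajectory_mem hG p (hG _ _ h (right_mem_segment ℝ _ _)))
      rw [Path.range_segment]
      exact hG _ _ h

/-! ### Evolution of the state -/

/-- The properties shared by all states of a run. -/
structure State.Valid {d : ℕ} (P : Problem d) (A : Params d) (s : State d) : Prop where
  two_le : 2 ≤ s.size
  pos_zero : s.pos 0 = P.qInit
  pos_one : s.pos 1 = P.qTarget
  adj : ∀ u v, s.graph.Adj u v →
    (u < s.size ∧ v < s.size) ∧ segment ℝ (s.pos u) (s.pos v) ⊆ P.free
  arm : ∃ a, s.arms[0]? = some a ∧ a.root = 0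
  length_le : s.arms.length ≤ max A.maxArms 2

/-- `t` has all vertices of `s`, and whatever is connected in `s` is connected in `t`. -/
structure State.Le {d : ℕ} (s t : State d) : Prop where
  size_le : s.size ≤ t.size
  pos_eq : ∀ v < s.size, t.pos v = s.pos v
  reachable : ∀ u v, s.graph.Reachable u v → t.graph.Reachable u v
  counter_le : s.counter ≤ t.counter

theorem State.Le.refl {d : ℕ} (s : State d) : s.Le s :=
  ⟨le_rfl, fun _ _ => rfl, fun _ _ => id, le_rfl⟩

theorem State.Le.trans {d : ℕ} {s t u : State d} (h : s.Le t) (h' : t.Le u) : s.Le u :=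
  ⟨h.size_le.trans h'.size_le,
    fun v hv => (h'.pos_eq v (hv.trans_le h.size_le)).trans (h.pos_eq v hv),
    fun a b hab => h'.reachable a b (h.reachable a b hab), h.counter_le.trans h'.counter_le⟩

/-- `t` differs from `s` in its graph only, all new edges are free, and connected vertices stay
connected. -/
structure State.Rerouted {d : ℕ} (P : Problem d) (s t : State d) : Prop where
  size_eq : t.size = s.size
  pos_eq : t.pos = s.pos
  arms_eq : t.arms = s.arms
  counter_eq : t.counter = s.counter
  reachable : ∀ u v, s.graph.Reachable u v → t.graph.Reachable u v
  adj : ∀ u v, t.graph.Adj u v → s.graph.Adj u v ∨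
    (u < s.size ∧ v < s.size) ∧ segment ℝ (s.pos u) (s.pos v) ⊆ P.free

theorem State.Rerouted.refl {d : ℕ} (P : Problem d) (s : State d) : s.Rerouted P s :=
  ⟨rfl, rfl, rfl, rfl, fun _ _ => id, fun _ _ => Or.inl⟩

theorem State.Rerouted.trans {d : ℕ} {P : Problem d} {s t u : State d} (h : s.Rerouted P t)
    (h' : t.Rerouted P u) : s.Rerouted P u where
  size_eq := h'.size_eq.trans h.size_eq
  pos_eq := h'.pos_eq.trans h.pos_eq
  arms_eq := h'.arms_eq.trans h.arms_eq
  counter_eq := h'.counter_eq.trans h.counter_eq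
  reachable := fun a b hab => h'.reachable a b (h.reachable a b hab)
  adj := fun a b hab => by
    rcases h'.adj a b hab with h1 | h1
    · exact h.adj a b h1
    · rw [h.size_eq, h.pos_eq] at h1
      exact Or.inr h1

theorem State.Rerouted.le {d : ℕ} {P : Problem d} {s t : State d} (h : s.Rerouted P t) :
    s.Le t :=
  ⟨h.size_eq.ge, fun _ _ => by rw [h.pos_eq], h.reachable, h.counter_eq.ge⟩

theorem State.Rerouted.valid {d : ℕ} {P : Problem d} {A : Params d} {s t : State d}
    (h : s.Rerouted P t) (hs : s.Valid P A) : t.Valid P A where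
  two_le := by rw [h.size_eq]; exact hs.two_le
  pos_zero := by rw [h.pos_eq]; exact hs.pos_zero
  pos_one := by rw [h.pos_eq]; exact hs.pos_one
  adj := fun u v huv => by
    rw [h.size_eq, h.pos_eq]
    exact (h.adj u v huv).elim (hs.adj u v) id
  arm := by rw [h.arms_eq]; exact hs.arm
  length_le := by rw [h.arms_eq]; exact hs.length_le

/-- Connectivity survives because `v` is not an ancestor of `m`; the cost comparison plays no role.
-/
theorem rerouted_rewireVertex {d : ℕ} (P : Problem d) (A : Params d) (s : State d) {m : ℕ}
    (hm : m < s.size) (v : ℕ) : s.Rerouted P (rewireVertex P A s m v) := by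
  unfold rewireVertex
  split_ifs with h hc
  · obtain ⟨⟨hv, -, hseg⟩, hsupp, -⟩ := hc
    refine ⟨rfl, rfl, rfl, rfl, fun x y hxy => reachable_reroute (treePath h.2).2 hsupp hxy, ?_⟩
    intro x y hxy
    rcases hxy with hxy | hxy
    · exact Or.inl (SimpleGraph.deleteEdges_adj.1 hxy).1
    · rcases (SimpleGraph.edge_adj _ _ _ _).1 hxy with ⟨⟨rfl, rfl⟩ | ⟨rfl, rfl⟩, -⟩
      · exact Or.inr ⟨⟨hm, hv⟩, segment_symm ℝ (s.pos y) (s.pos x) ▸ hseg⟩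
      · exact Or.inr ⟨⟨hv, hm⟩, hseg⟩
  · exact .refl P s
  · exact .refl P s

theorem rerouted_rewire {d : ℕ} (P : Problem d) (A : Params d) (s : State d) {m : ℕ}
    (hm : m < s.size) : s.Rerouted P (rewire P A s m) := by
  unfold rewire
  generalize List.range s.size = l
  suffices ∀ t, s.Rerouted P t →
      s.Rerouted P (l.foldl (fun t v => rewireVertex P A t m v) t) from this s (.refl P s)
  induction l with
  | nil => exact fun t ht => ht
  | cons v l ih =>
    exact fun t ht => ih _ (ht.trans (rerouted_rewireVertex P A t (ht.size_eq ▸ hm) v))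

/-! ### Joining a configuration to the forest -/

theorem exists_isLink {d : ℕ} {P : Problem d} {A : Params d} {s : State d} (origin : Option ℕ)
    {q : Config d} {w : ℕ} (hw : s.Connectable P A q w) :
    ∃ v, s.IsLink P A origin q v ∧ s.graph.Reachable w v := by
  classical
  let T := (Finset.range s.size).filter fun v => s.Connectable P A q v ∧ s.graph.Reachable w v
  -- The lexicographic order on key and index encodes the tie-breaking rule.
  obtain ⟨v, hv, hmin⟩ := T.exists_min_image
    (fun v => toLex (s.linkKey P origin q v, v))
    ⟨w, Finset.mem_filter.2 ⟨Finset.mem_range.2 hw.1, hw, .refl _⟩⟩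
  obtain ⟨-, hv, hwv⟩ := Finset.mem_filter.1 hv
  refine ⟨v, ⟨hv, fun u hu hvu => ?_⟩, hwv⟩
  exact Prod.Lex.le_iff.1
    (hmin u (Finset.mem_filter.2 ⟨Finset.mem_range.2 hu.1, hu, hwv.trans hvu⟩))

theorem State.le_join {d : ℕ} (P : Problem d) (A : Params d) (s : State d) (origin : Option ℕ)
    (q : Config d) : s.Le (s.join P A origin q) where
  size_le := Nat.le_succ _
  pos_eq := fun _ hv => Function.update_of_ne hv.ne _ _
  reachable := fun _ _ h => h.mono le_sup_left
  counter_le := le_rfl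

theorem State.Valid.join {d : ℕ} {P : Problem d} {A : Params d} {s : State d}
    (hs : s.Valid P A) (origin : Option ℕ) (q : Config d) :
    (s.join P A origin q).Valid P A where
  two_le := hs.two_le.trans (Nat.le_succ _)
  pos_zero := ((s.le_join P A origin q).pos_eq 0 (by have := hs.two_le; lia)).trans hs.pos_zero
  pos_one := ((s.le_join P A origin q).pos_eq 1 (by have := hs.two_le; lia)).trans hs.pos_one
  adj := by
    have key : ∀ v, s.Connectable P A q v →
        segment ℝ (Function.update s.pos s.size q v) (Function.update s.pos s.size q s.size)
          ⊆ P.free := by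
      intro v hv
      rw [Function.update_self, Function.update_of_ne hv.1.ne]
      exact hv.2.2
    rintro u v (h | h)
    · obtain ⟨⟨hu, hv⟩, hseg⟩ := hs.adj u v h
      refine ⟨⟨Nat.lt_succ_of_lt hu, Nat.lt_succ_of_lt hv⟩, ?_⟩
      simpa only [State.join, Function.update_of_ne hu.ne, Function.update_of_ne hv.ne] using hseg
    · obtain ⟨⟨x, hx, he⟩, -⟩ := (SimpleGraph.fromEdgeSet_adj _).1 h
      have hxs := hx.1.1
      rcases Sym2.eq_iff.1 he with ⟨rfl, rfl⟩ | ⟨rfl, rfl⟩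
      · exact ⟨⟨Nat.lt_succ_of_lt hxs, Nat.lt_succ_self _⟩, key _ hx.1⟩
      · refine ⟨⟨Nat.lt_succ_self _, Nat.lt_succ_of_lt hxs⟩, ?_⟩
        rw [segment_symm]
        exact key _ hx.1
  arm := hs.arm
  length_le := hs.length_le

/-- The edge may go to another vertex than `w`, but it goes to one in the tree of `w`. -/
theorem reachable_join {d : ℕ} {P : Problem d} {A : Params d} {s : State d} (origin : Option ℕ)
    {q : Config d} {w : ℕ} (hw : s.Connectable P A q w) :
    (s.join P A origin q).graph.Reachable w s.size := by
  obtain ⟨v, hv, hwv⟩ := exists_isLink origin hw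
  refine ((s.le_join P A origin q).reachable _ _ hwv).trans (SimpleGraph.Adj.reachable (Or.inr ?_))
  exact (SimpleGraph.fromEdgeSet_adj _).2 ⟨⟨v, hv, rfl⟩, hv.1.1.ne⟩

theorem State.rerouted_insert {d : ℕ} (P : Problem d) (A : Params d) (s : State d)
    (origin : Option ℕ) (q : Config d) :
    (s.join P A origin q).Rerouted P (s.insert P A origin q) :=
  rerouted_rewire P A _ (Nat.lt_succ_self s.size)

theorem State.le_insert {d : ℕ} (P : Problem d) (A : Params d) (s : State d)
    (origin : Option ℕ) (q : Config d) : s.Le (s.insert P A origin q) :=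
  (s.le_join P A origin q).trans (s.rerouted_insert P A origin q).le

theorem State.Valid.insert {d : ℕ} {P : Problem d} {A : Params d} {s : State d}
    (hs : s.Valid P A) (origin : Option ℕ) (q : Config d) : (s.insert P A origin q).Valid P A :=
  (s.rerouted_insert P A origin q).valid (hs.join origin q)

theorem State.insert_arms {d : ℕ} (P : Problem d) (A : Params d) (s : State d)
    (origin : Option ℕ) (q : Config d) : (s.insert P A origin q).arms = s.arms :=
  (s.rerouted_insert P A origin q).arms_eq

theorem State.Valid.of_arms {d : ℕ} {P : Problem d} {A : Params d} {s : State d}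
    (hs : s.Valid P A) {l : List (Arm d)} {n : ℕ} (h : ∃ a, l[0]? = some a ∧ a.root = 0)
    (hl : l.length ≤ max A.maxArms 2) : State.Valid P A { s with arms := l, counter := n } :=
  ⟨hs.two_le, hs.pos_zero, hs.pos_one, hs.adj, h, hl⟩

/-- Neither the arms nor the counter matter for the vertices and the graph. -/
theorem State.Le.of_arms {d : ℕ} {s t : State d} (h : s.Le t) {l : List (Arm d)} {n : ℕ}
    (hn : s.counter ≤ n) : s.Le { t with arms := l, counter := n } :=
  ⟨h.size_le, h.pos_eq, h.reachable, hn⟩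

theorem State.valid_initial {d : ℕ} (P : Problem d) (A : Params d) :
    (State.initial P).Valid P A where
  two_le := le_rfl
  pos_zero := by simp [State.initial]
  pos_one := by simp [State.initial]
  adj := fun _ _ h => h.elim
  arm := ⟨Arm.new 0, rfl, rfl⟩
  -- The two initial arms may exceed `maxArms`, hence the maximum with `2`.
  length_le := le_max_right _ _

/-! ### Proposals, arm updates and extensions -/

theorem State.le_propose {d : ℕ} (P : Problem d) (A : Params d) (s : State d)
    (p : Config d × ℝ) : s.Le (s.propose P A p) := by
  have h := s.le_insert P A none p.1
  unfold State.propose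
  split_ifs
  · exact h
  · exact h.of_arms h.counter_le
  · exact .refl s

theorem State.propose_arms {d : ℕ} (P : Problem d) (A : Params d) (s : State d)
    (p : Config d × ℝ) {a : Arm d} (ha : s.arms[0]? = some a) :
    (s.propose P A p).arms[0]? = some a := by
  unfold State.propose
  split_ifs
  · rwa [State.insert_arms]
  · have : 0 < s.arms.length := (List.getElem?_eq_some_iff.1 ha).1
    simp only [State.insert_arms]
    rwa [List.getElem?_append_left this]
  · exact ha

theorem State.Valid.propose {d : ℕ} {P : Problem d} {A : Params d} {s : State d}
    (hs : s.Valid P A) (p : Config d × ℝ) : (s.propose P A p).Valid P A := by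
  obtain ⟨a, ha, ha0⟩ := hs.arm
  have harm := s.propose_arms P A p ha
  revert harm
  unfold State.propose
  split_ifs with h1 h2 <;> intro harm
  · exact hs.insert _ _
  · refine (hs.insert none p.1).of_arms ⟨a, harm, ha0⟩ ?_
    rw [State.insert_arms, List.length_append]
    exact le_max_of_le_left h1.1
  · exact hs

theorem State.le_updateArm {d : ℕ} (A : Params d) {s t : State d} (h : s.Le t) (i : ℕ)
    (a : Arm d) : s.Le (t.updateArm A i a) := by
  unfold State.updateArm
  split_ifs
  exacts [h.of_arms h.counter_le, h.of_arms h.counter_le]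

theorem State.updateArm_arms_of_ne {d : ℕ} (A : Params d) (s : State d) {i : ℕ} (hi : i ≠ 0)
    (a : Arm d) : (s.updateArm A i a).arms[0]? = s.arms[0]? := by
  unfold State.updateArm
  split_ifs
  · simp only
    rw [List.getElem?_eraseIdx_of_lt (Nat.pos_of_ne_zero hi)]
  · simp only
    rw [List.getElem?_set_ne hi]

/-- Pruning spares the first arm, whose root `0` makes it rooted; erasing a later arm does not shift
position `0`. -/
theorem State.Valid.updateArm {d : ℕ} {P : Problem d} {A : Params d} {s : State d}
    (hs : s.Valid P A) (i : ℕ) {a : Arm d} (ha : i = 0 → a.root = 0) :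
    (s.updateArm A i a).Valid P A := by
  have harm : ∃ b, (s.updateArm A i a).arms[0]? = some b ∧ b.root = 0 := by
    rcases eq_or_ne i 0 with rfl | hi
    · refine ⟨a, ?_, ha rfl⟩
      have hr : s.Rooted a.root := by rw [ha rfl]; exact Or.inl (.refl _)
      obtain ⟨b, hb, -⟩ := hs.arm
      have hl := (List.getElem?_eq_some_iff.1 hb).1
      simp [State.updateArm, hr, hl]
    · rw [State.updateArm_arms_of_ne A s hi]
      exact hs.arm
  revert harm
  unfold State.updateArm
  split_ifs <;> intro harm
  · exact hs.of_arms harm ((List.length_eraseIdx_le _ _).trans hs.length_le)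
  · exact hs.of_arms harm ((List.length_set ..).trans_le hs.length_le)

/-- An extension step either does nothing, or inserts a vertex and updates the arm, or only updates
the arm. -/
theorem State.extend_cases {d : ℕ} (P : Problem d) (A : Params d) (s : State d) (i : ℕ)
    (y : Config d) : s.extend P A i y = s ∨ ∃ a b, s.arms[i]? = some a ∧ b.root = a.root ∧
      ((∃ o q, s.extend P A i y =
        State.updateArm A { s.insert P A o q with counter := s.counter + 1 } i b) ∨
      s.extend P A i y = State.updateArm A s i b) := by
  classical
  unfold State.extend
  split
  · exact Or.inl rfl
  · rename_i a ha
    refine Or.inr ⟨a, ?_⟩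
    dsimp only
    generalize (if s.Rooted a.root then s.closest a.root y else a.loc) = o
    generalize (if s.Rooted a.root then steer A.ε (s.pos o) y else s.pos o + A.ε • y) = q
    by_cases h : segment ℝ (s.pos o) q ⊆ P.free
    · rw [if_pos h]
      exact ⟨_, ha, by rfl, Or.inl ⟨_, _, rfl⟩⟩
    · rw [if_neg h]
      exact ⟨_, ha, by rfl, Or.inr rfl⟩

theorem State.le_extend {d : ℕ} (P : Problem d) (A : Params d) (s : State d) (i : ℕ)
    (y : Config d) : s.Le (s.extend P A i y) := by
  rcases s.extend_cases P A i y with h | ⟨a, b, -, -, ⟨o, q, h⟩ | h⟩ <;> rw [h]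
  · exact .refl s
  · exact State.le_updateArm A ((s.le_insert P A o q).of_arms (Nat.le_succ _)) i b
  · exact State.le_updateArm A (.refl s) i b

theorem State.extend_arms_of_ne {d : ℕ} (P : Problem d) (A : Params d) (s : State d) {i : ℕ}
    (hi : i ≠ 0) (y : Config d) : (s.extend P A i y).arms[0]? = s.arms[0]? := by
  rcases s.extend_cases P A i y with h | ⟨a, b, -, -, ⟨o, q, h⟩ | h⟩ <;> rw [h]
  · rw [State.updateArm_arms_of_ne A _ hi]
    simp only [State.insert_arms]
  · rw [State.updateArm_arms_of_ne A _ hi]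

theorem State.Valid.extend {d : ℕ} {P : Problem d} {A : Params d} {s : State d}
    (hs : s.Valid P A) (i : ℕ) (y : Config d) : (s.extend P A i y).Valid P A := by
  rcases s.extend_cases P A i y with h | ⟨a, b, ha, hb, h⟩
  · rwa [h]
  have hroot : i = 0 → b.root = 0 := by
    rintro rfl
    obtain ⟨c, hc, hc0⟩ := hs.arm
    rw [ha] at hc
    rw [hb, Option.some.inj hc, hc0]
  rcases h with ⟨o, q, h⟩ | h <;> rw [h]
  · have hi := hs.insert o q
    exact (hi.of_arms hi.arm hi.length_le).updateArm i hroot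
  · exact hs.updateArm i hroot

/-! ### Growth of the tree rooted at `qInit` -/

/-- The infimum is attained because a finite nonempty set of vertices has a minimiser of the
distance. -/
theorem State.closest_spec {d : ℕ} (s : State d) {root v : ℕ} (hv : v < s.size)
    (hr : s.graph.Reachable root v) (y : Config d) :
    s.closest root y < s.size ∧ s.graph.Reachable root (s.closest root y) ∧
      ∀ w < s.size, s.graph.Reachable root w →
        dist (s.pos (s.closest root y)) y ≤ dist (s.pos w) y := by
  classical
  obtain ⟨u, hu, hmin⟩ := ((Finset.range s.size).filter (s.graph.Reachable root)).exists_min_image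
    (fun w => dist (s.pos w) y) ⟨v, Finset.mem_filter.2 ⟨Finset.mem_range.2 hv, hr⟩⟩
  obtain ⟨hu, hru⟩ := Finset.mem_filter.1 hu
  exact Nat.sInf_mem (s := {v | v < s.size ∧ s.graph.Reachable root v ∧
    ∀ w < s.size, s.graph.Reachable root w → dist (s.pos v) y ≤ dist (s.pos w) y})
    ⟨u, Finset.mem_range.1 hu, hru, fun w hw hrw =>
      hmin w (Finset.mem_filter.2 ⟨Finset.mem_range.2 hw, hrw⟩)⟩

/-- A vertex of the tree rooted at `qInit` lies in the closed ball of radius `r` about `x`. -/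
def State.Covers {d : ℕ} (s : State d) (x : Config d) (r : ℝ) : Prop :=
  ∃ v < s.size, s.graph.Reachable 0 v ∧ dist (s.pos v) x ≤ r

theorem State.Covers.mono {d : ℕ} {s t : State d} {x : Config d} {r : ℝ} (h : s.Covers x r)
    (hst : s.Le t) : t.Covers x r := by
  obtain ⟨v, hv, hr, hd⟩ := h
  exact ⟨v, hv.trans_le hst.size_le, hst.reachable _ _ hr, by rwa [hst.pos_eq v hv]⟩

/-- If a sample close to the tree rooted at `qInit` is drawn for the arm of that tree, it becomes a
vertex, and the tree merges with all trees nearby. -/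
theorem State.Valid.extend_success {d : ℕ} {P : Problem d} {A : Params d} {s : State d}
    (hs : s.Valid P A) {x x' y : Config d} {r : ℝ} (hε : 3 * r ≤ A.ε)
    (hfree : Metric.closedBall x' (4 * r) ⊆ P.free) (hx : s.Covers x r) (hxx : dist x x' ≤ r)
    (hy : dist y x' ≤ r) :
    (s.extend P A 0 y).Covers x' r ∧ (s.extend P A 0 y).counter = s.counter + 1 ∧
      (dist P.qTarget x' ≤ r → (s.extend P A 0 y).graph.Reachable 0 1) := by
  obtain ⟨a, ha, ha0⟩ := hs.arm
  obtain ⟨v, hv, hrv, hdv⟩ := hx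
  have hroot : s.Rooted a.root := by rw [ha0]; exact Or.inl (.refl _)
  obtain ⟨hc, hrc, hmin⟩ := s.closest_spec hv hrv y
  -- Both ends lie in the ball of radius `4 * r` about `x'`, which is convex and free.
  have hfar : ∀ z, dist z y ≤ 3 * r → segment ℝ z y ⊆ P.free := by
    intro z hz
    refine ((convex_closedBall x' (4 * r)).segment_subset ?_ ?_).trans hfree
    · have := dist_triangle z y x'
      exact Metric.mem_closedBall.2 (by linarith)
    · have := dist_nonneg (x := y) (y := x')
      exact Metric.mem_closedBall.2 (by linarith)
  -- Three hops of length at most `r`: from the vertex to `x`, to `x'`, to the sample.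
  have hvy : dist (s.pos v) y ≤ 3 * r := by
    have h1 := dist_triangle (s.pos v) x y
    have h2 := dist_triangle x x' y
    rw [dist_comm x' y] at h2
    linarith
  have hcy : dist (s.pos (s.closest 0 y)) y ≤ 3 * r := (hmin v hv hrv).trans hvy
  have hsteer : steer A.ε (s.pos (s.closest 0 y)) y = y := if_pos (hcy.trans hε)
  obtain ⟨b, hext⟩ : ∃ b, s.extend P A 0 y = State.updateArm A
      { s.insert P A (some (s.closest 0 y)) y with counter := s.counter + 1 } 0 b := by
    classical
    have ho : (if s.Rooted a.root then s.closest a.root y else a.loc) = s.closest 0 y := by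
      rw [if_pos hroot, ha0]
    have hq : (if s.Rooted a.root then steer A.ε (s.pos (s.closest 0 y)) y
        else s.pos (s.closest 0 y) + A.ε • y) = y := by
      rw [if_pos hroot, hsteer]
    unfold State.extend
    rw [ha]
    dsimp only
    rw [ho, hq, if_pos (hfar _ hcy)]
    exact ⟨_, rfl⟩
  set o : Option ℕ := some (s.closest 0 y)
  -- The comparison starts from the joined state, where the new vertex `s.size` already exists.
  have hle : (s.join P A o y).Le (s.extend P A 0 y) := by
    rw [hext]
    exact State.le_updateArm A ((s.rerouted_insert P A o y).le.of_arms (Nat.le_succ _)) 0 b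
  have hcon : ∀ w < s.size, dist (s.pos w) y ≤ 3 * r →
      (s.extend P A 0 y).graph.Reachable w s.size := fun w hw hd =>
    hle.reachable _ _ (reachable_join o ⟨hw, hd.trans hε, hfar _ hd⟩)
  have h0 : (s.extend P A 0 y).graph.Reachable 0 s.size :=
    ((s.le_extend P A 0 y).reachable _ _ hrc).trans (hcon _ hc hcy)
  refine ⟨⟨s.size, hle.size_le, h0, ?_⟩, ?_, fun hT => ?_⟩
  · rw [hle.pos_eq s.size (Nat.lt_succ_self _)]
    simpa [State.join] using hy
  · rw [hext]
    unfold State.updateArm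
    split_ifs <;> rfl
  · refine h0.trans (hcon 1 hs.two_le ?_).symm
    have := dist_triangle P.qTarget x' y
    rw [hs.pos_one]
    rw [dist_comm x' y] at this
    linarith [dist_nonneg (x := y) (y := x')]

theorem State.Valid.solved {d : ℕ} {P : Problem d} {A : Params d} {s : State d}
    (hs : s.Valid P A) (hP : P.qInit ∈ P.free) (h : s.graph.Reachable 0 1) : s.Solved P := by
  refine ⟨(trajectory s.pos (treePath h).1).toContinuousMap, ?_, ?_, ?_, fun τ => ?_⟩
  · simp [State.solution, h]
  · exact (Path.source _).trans hs.pos_zero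
  · exact (Path.target _).trans hs.pos_one
  · exact trajectory_mem (fun u v huv => (hs.adj u v huv).2) (treePath h).1
      (by rwa [hs.pos_zero]) ⟨τ, rfl⟩

/-! ### Runs -/

section Run

variable {d : ℕ} {P : Problem d} {A : Params d} {proposal : ℕ → Config d × ℝ}
  {draw : ℕ → ℕ × Config d}

theorem valid_stateAt (t : ℕ) : (stateAt P A proposal draw t).Valid P A := by
  induction t with
  | zero => exact State.valid_initial P A
  | succ t ih => exact (ih.propose _).extend _ _

theorem stateAt_le {t u : ℕ} (h : t ≤ u) :
    (stateAt P A proposal draw t).Le (stateAt P A proposal draw u) := by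
  induction u, h using Nat.le_induction with
  | base => exact .refl _
  | succ u _ ih => exact ih.trans ((State.le_propose _ _ _ _).trans (State.le_extend _ _ _ _ _))

/-- Samples near the points of a chain, drawn infinitely often for the first arm, let the tree
rooted at `qInit` grow along the chain. -/
theorem eventually_solved_of_frequently {r : ℝ} (hr : 0 ≤ r) (hε : 3 * r ≤ A.ε) {n : ℕ}
    {x : ℕ → Config d}
    (hx0 : x 0 = P.qInit) (hxn : x n = P.qTarget) (hx : ∀ j < n, dist (x j) (x (j + 1)) ≤ r)
    (hfree : ∀ j ≤ n, Metric.closedBall (x j) (4 * r) ⊆ P.free)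
    (hdraw : ∀ j ≤ n, ∃ᶠ t in atTop, draw t ∈ ({0} : Set ℕ) ×ˢ Metric.closedBall (x j) r) :
    (∀ᶠ t in atTop, (stateAt P A proposal draw t).Solved P) ∧
      ∀ N, ∃ t, N < (stateAt P A proposal draw t).counter := by
  have hstep : ∀ {j t : ℕ} {z : Config d}, j ≤ n →
      draw t ∈ ({0} : Set ℕ) ×ˢ Metric.closedBall (x j) r →
      (stateAt P A proposal draw t).Covers z r → dist z (x j) ≤ r →
      (stateAt P A proposal draw (t + 1)).Covers (x j) r ∧
        (stateAt P A proposal draw t).counter < (stateAt P A proposal draw (t + 1)).counter ∧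
        (dist P.qTarget (x j) ≤ r →
          (stateAt P A proposal draw (t + 1)).graph.Reachable 0 1) := by
    intro j t z hj ht hz hzj
    have hle := (stateAt P A proposal draw t).le_propose P A (proposal t)
    have h := ((valid_stateAt t).propose (proposal t)).extend_success hε (hfree j hj)
      (hz.mono hle) hzj (Metric.mem_closedBall.1 ht.2)
    have h0 : (draw t).1 = 0 := ht.1
    rw [stateAt, h0]
    exact ⟨h.1, by rw [h.2.1]; exact Nat.lt_succ_of_le hle.counter_le, h.2.2⟩
  have hinit : ∀ t, (stateAt P A proposal draw t).Covers (x 0) r := fun t => by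
    have hv := valid_stateAt (P := P) (A := A) (proposal := proposal) (draw := draw) t
    exact ⟨0, by have := hv.two_le; lia, .refl _, by rw [hv.pos_zero, hx0, dist_self]; exact hr⟩
  have hP : P.qInit ∈ P.free :=
    hfree 0 n.zero_le (by rw [hx0]; exact Metric.mem_closedBall_self (by linarith))
  have hcov : ∀ j ≤ n, ∃ t, (stateAt P A proposal draw t).Covers (x j) r := by
    intro j
    induction j with
    | zero => exact fun _ => ⟨0, hinit 0⟩
    | succ j ih =>
      intro hj
      obtain ⟨t, ht⟩ := ih (by lia)
      obtain ⟨u, htu, hu⟩ := frequently_atTop.1 (hdraw (j + 1) hj) t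
      exact ⟨u + 1, (hstep hj hu (ht.mono (stateAt_le htu)) (hx j hj)).1⟩
  constructor
  · obtain ⟨t, ht⟩ := hcov n le_rfl
    obtain ⟨u, htu, hu⟩ := frequently_atTop.1 (hdraw n le_rfl) t
    have h := (hstep le_rfl hu (ht.mono (stateAt_le htu)) (by rwa [dist_self])).2.2
      (by rwa [hxn, dist_self])
    filter_upwards [eventually_ge_atTop (u + 1)] with w hw
    exact (valid_stateAt w).solved hP ((stateAt_le hw).reachable _ _ h)
  -- The ball about `qInit` is always covered, so every hit of it raises the counter.
  · intro N
    induction N with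
    | zero =>
      obtain ⟨u, -, hu⟩ := frequently_atTop.1 (hdraw 0 n.zero_le) 0
      exact ⟨u + 1, pos_of_gt (hstep n.zero_le hu (hinit u) (by rwa [dist_self])).2.1⟩
    | succ N ih =>
      obtain ⟨t, ht⟩ := ih
      obtain ⟨u, htu, hu⟩ := frequently_atTop.1 (hdraw 0 n.zero_le) t
      have h1 := (hstep n.zero_le hu (hinit u) (by rwa [dist_self])).2.1
      have h2 := (stateAt_le (P := P) (A := A) (proposal := proposal) (draw := draw)
        htu).counter_le
      exact ⟨u + 1, by lia⟩

theorem exists_stopsAt {N : ℕ} (h : ∃ t, N < (stateAt P A proposal draw t).counter) :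
    ∃ i, StopsAt P A proposal draw N i := by
  classical
  exact ⟨Nat.find h, Nat.find_spec h, fun j hj => not_lt.1 (Nat.find_min h hj)⟩

/-- The counter is monotone, so the loop cannot stop before pass `t` once `N` is at least the
counter at `t`. -/
theorem eventually_stopsAt_solved
    (hsol : ∀ᶠ t in atTop, (stateAt P A proposal draw t).Solved P)
    (hcount : ∀ N, ∃ t, N < (stateAt P A proposal draw t).counter) :
    ∀ᶠ N in atTop, ∃ i, StopsAt P A proposal draw N i ∧
      (stateAt P A proposal draw i).Solved P := by
  obtain ⟨t, ht⟩ := eventually_atTop.1 hsol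
  filter_upwards [eventually_ge_atTop (stateAt P A proposal draw t).counter] with N hN
  obtain ⟨i, hi⟩ := exists_stopsAt (hcount N)
  refine ⟨i, hi, ht i (le_of_not_gt fun hlt => ?_)⟩
  exact absurd hi.1 (not_lt.2 ((stateAt_le hlt.le).counter_le.trans hN))

/-- As long as the first arm is not drawn it does not change. -/
theorem eventually_arm_const (h : ∀ᶠ t in atTop, (draw t).1 ≠ 0) :
    ∃ a : Arm d, a.root = 0 ∧
      ∀ᶠ t in atTop, (stateAt P A proposal draw t).arms[0]? = some a := by
  obtain ⟨T, hT⟩ := eventually_atTop.1 h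
  obtain ⟨a, ha, ha0⟩ := (valid_stateAt (P := P) (A := A) (proposal := proposal)
    (draw := draw) T).arm
  refine ⟨a, ha0, eventually_atTop.2 ⟨T, fun t ht => ?_⟩⟩
  induction t, ht using Nat.le_induction with
  | base => exact ha
  | succ t ht ih =>
    rw [stateAt, State.extend_arms_of_ne P A _ (hT t ht)]
    exact State.propose_arms P A _ _ ih

end Run

/-! ### Probabilities -/

/-- The law of a draw, on the event that the first arm is picked. -/
theorem State.Valid.drawLaw_real {d : ℕ} {P : Problem d} {A : Params d} {s : State d}
    (hs : s.Valid P A) {a : Arm d} (ha : s.arms[0]? = some a) {B : Set (Config d)}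
    (hB : MeasurableSet B) :
    (s.drawLaw P A).real (({0} : Set ℕ) ×ˢ B) =
      s.armProb A a / (∑ j : Fin s.arms.length, s.armProb A s.arms[j]) *
        (ProbabilityTheory.cond volume P.free).real B := by
  have hl : 0 < s.arms.length := (List.getElem?_eq_some_iff.1 ha).1
  have hget : s.arms[0] = a := (List.getElem?_eq_some_iff.1 ha).2
  have ha0 : a.root = 0 := by
    obtain ⟨b, hb, hb0⟩ := hs.arm
    rw [ha] at hb
    rwa [Option.some.inj hb]
  have hroot : s.Rooted a.root := by rw [ha0]; exact Or.inl (.refl _)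
  have hmeas : ∀ i : ℕ, Measurable fun y : Config d => (i, y) := fun i => by fun_prop
  have hC : MeasurableSet (({0} : Set ℕ) ×ˢ B) := (MeasurableSet.singleton 0).prod hB
  have hnn : 0 ≤ s.armProb A a / (∑ j : Fin s.arms.length, s.armProb A s.arms[j]) :=
    div_nonneg (A.successProb _ _).2.1.le
      (Finset.sum_nonneg fun j _ => (A.successProb _ _).2.1.le)
  rw [measureReal_def, measureReal_def, State.drawLaw, Measure.coe_finsetSum, Finset.sum_apply,
    Finset.sum_eq_single (⟨0, hl⟩ : Fin s.arms.length)]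
  · have hpre : (fun y : Config d => ((0 : ℕ), y)) ⁻¹' (({0} : Set ℕ) ×ˢ B) = B := by
      ext y; simp
    simp only [Measure.smul_apply, smul_eq_mul, Fin.getElem_fin, hget]
    rw [Measure.map_apply (hmeas 0) hC, hpre, ENNReal.toReal_mul, State.sampleLaw, if_pos hroot,
      ENNReal.toReal_ofReal (by simpa using hnn)]
  · intro i _ hi
    have hi0 : (i : ℕ) ≠ 0 := fun h => hi (Fin.ext h)
    have hpre : (fun y : Config d => ((i : ℕ), y)) ⁻¹' (({0} : Set ℕ) ×ˢ B) = ∅ := by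
      ext y; simp [hi0]
    rw [Measure.smul_apply, Measure.map_apply (hmeas i) hC, hpre, measure_empty, smul_zero]
  · exact fun h => (h (Finset.mem_univ _)).elim

/-- Bounds the normalising constant of the arm selection uniformly over all states of a run. -/
theorem State.Valid.sum_armProb_le {d : ℕ} {P : Problem d} {A : Params d} {s : State d}
    (hs : s.Valid P A) :
    ∑ j : Fin s.arms.length, s.armProb A s.arms[j] ≤ (max A.maxArms 2 : ℕ) := by
  calc ∑ j : Fin s.arms.length, s.armProb A s.arms[j]
      ≤ ∑ _j : Fin s.arms.length, (1 : ℝ) :=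
        Finset.sum_le_sum fun j _ => (A.successProb _ _).2.2
    _ = (s.arms.length : ℝ) := by simp
    _ ≤ (max A.maxArms 2 : ℕ) := Nat.cast_le.2 hs.length_le

theorem State.Valid.sum_armProb_pos {d : ℕ} {P : Problem d} {A : Params d} {s : State d}
    (hs : s.Valid P A) : 0 < ∑ j : Fin s.arms.length, s.armProb A s.arms[j] := by
  obtain ⟨a, ha, -⟩ := hs.arm
  exact Finset.sum_pos (fun j _ => (A.successProb _ _).2.1)
    ⟨⟨0, (List.getElem?_eq_some_iff.1 ha).1⟩, Finset.mem_univ _⟩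

theorem tendsto_sum_atTop_of_eventually_ge {f : ℕ → ℝ} {c : ℝ} (hc : 0 < c)
    (h : ∀ᶠ t in atTop, c ≤ f t) :
    Tendsto (fun n => ∑ t ∈ Finset.range n, f t) atTop atTop := by
  obtain ⟨T, hT⟩ := eventually_atTop.1 h
  have hlin : Tendsto (fun n : ℕ => (∑ t ∈ Finset.range T, f t) + (n : ℝ) * c) atTop atTop :=
    tendsto_atTop_add_const_left _ _ (tendsto_natCast_atTop_atTop.atTop_mul_const hc)
  rw [← tendsto_add_atTop_iff_nat T]
  refine tendsto_atTop_mono (fun n => ?_) hlin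
  rw [Nat.add_comm, Finset.sum_range_add]
  gcongr
  calc (n : ℝ) * c = ∑ _t ∈ Finset.range n, c := by simp
    _ ≤ _ := Finset.sum_le_sum fun t _ => hT _ (Nat.le_add_right _ _)

/-- The conditional second Borel-Cantelli lemma for the draws of a run. -/
theorem IsRun.ae_frequently_iff {d : ℕ} {P : Problem d} {A : Params d} {Ω : Type*}
    {mΩ : MeasurableSpace Ω} {μ : Measure Ω} [IsProbabilityMeasure μ] {ℱ : Filtration ℕ mΩ}
    {proposal : ℕ → Ω → Config d × ℝ} {draw : ℕ → Ω → ℕ × Config d}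
    (hrun : IsRun P A μ ℱ proposal draw) {C : Set (ℕ × Config d)} (hC : MeasurableSet C) :
    ∀ᵐ ω ∂μ, (∃ᶠ t in atTop, draw t ω ∈ C) ↔
      Tendsto (fun n => ∑ t ∈ Finset.range n,
        (((stateAt P A (proposal · ω) (draw · ω) t).propose P A (proposal t ω)).drawLaw P A).real
          C) atTop atTop := by
  -- The draw of pass `t` is known only at time `t + 1`, hence the shift; the set at time `0` is a
  -- dummy.
  let S : ℕ → Set Ω := fun n => Nat.casesOn n ∅ fun t => draw t ⁻¹' C
  have hS : ∀ n, MeasurableSet[ℱ n] (S n) := by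
    intro n
    cases n with
    | zero => exact @MeasurableSet.empty _ (ℱ 0)
    | succ t => exact hrun.measurable_draw t hC
  filter_upwards [ae_mem_limsup_atTop_iff μ hS, ae_all_iff.2 fun t => hrun.draw_law t C hC]
    with ω h1 h2
  have h3 : ω ∈ limsup S atTop ↔ ∃ᶠ t in atTop, draw t ω ∈ C := by
    rw [mem_limsup_iff_frequently_mem, ← map_add_atTop_eq_nat 1, frequently_map,
      map_add_atTop_eq_nat]
    rfl
  rw [← h3, h1]
  refine iff_of_eq (congrArg (fun f => Tendsto f atTop atTop) (funext fun n => ?_))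
  exact Finset.sum_congr rfl fun t _ => h2 t

/-- Almost surely, every measurable set that has a positive share of the free space is hit
infinitely often by samples drawn for the first arm. -/
theorem IsRun.ae_frequently_mem {d : ℕ} {P : Problem d} {A : Params d} {Ω : Type*}
    {mΩ : MeasurableSpace Ω} {μ : Measure Ω} [IsProbabilityMeasure μ] {ℱ : Filtration ℕ mΩ}
    {proposal : ℕ → Ω → Config d × ℝ} {draw : ℕ → Ω → ℕ × Config d}
    (hrun : IsRun P A μ ℱ proposal draw) {B : Set (Config d)} (hB : MeasurableSet B)
    (hpos : 0 < (ProbabilityTheory.cond volume P.free).real B) :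
    ∀ᵐ ω ∂μ, ∃ᶠ t in atTop, draw t ω ∈ ({0} : Set ℕ) ×ˢ B := by
  have hprod : ∀ D : Set (Config d), MeasurableSet D →
      MeasurableSet (({0} : Set ℕ) ×ˢ D) := fun D hD => (MeasurableSet.singleton 0).prod hD
  have hcond : (ProbabilityTheory.cond volume P.free).real Set.univ = 1 := by
    -- For volume `0` or `⊤` the conditioned measure would vanish, against `hpos`.
    have hne : (volume : Measure (Config d)) P.free ≠ 0 ∧
        (volume : Measure (Config d)) P.free ≠ ⊤ := by
      refine ⟨fun h => ?_, fun h => ?_⟩ <;>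
        simp [measureReal_def, ProbabilityTheory.cond, h] at hpos
    have : IsProbabilityMeasure (ProbabilityTheory.cond volume P.free) :=
      ProbabilityTheory.cond_isProbabilityMeasure_of_finite hne.1 hne.2
    exact probReal_univ
  filter_upwards [hrun.ae_frequently_iff (hprod _ hB),
    hrun.ae_frequently_iff (hprod _ MeasurableSet.univ)] with ω hωB hω
  set s : ℕ → State d := fun t =>
    (stateAt P A (proposal · ω) (draw · ω) t).propose P A (proposal t ω) with hs
  have hval : ∀ t, (s t).Valid P A := fun t => (valid_stateAt t).propose _
  have hscale : ∀ t, ((s t).drawLaw P A).real (({0} : Set ℕ) ×ˢ B) =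
      ((s t).drawLaw P A).real (({0} : Set ℕ) ×ˢ Set.univ) *
        (ProbabilityTheory.cond volume P.free).real B := by
    intro t
    obtain ⟨a, ha, -⟩ := (hval t).arm
    rw [(hval t).drawLaw_real ha hB, (hval t).drawLaw_real ha MeasurableSet.univ, hcond, mul_one]
  have hpick : ∃ᶠ t in atTop, draw t ω ∈ ({0} : Set ℕ) ×ˢ (Set.univ : Set (Config d)) := by
    by_contra hnot
    have hne : ∀ᶠ t in atTop, (draw t ω).1 ≠ 0 :=
      (not_frequently.1 hnot).mono fun t ht h => ht ⟨h, Set.mem_univ _⟩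
    -- The frozen record `a.log` gives a constant positive lower bound on the chance of picking the
    -- first arm.
    obtain ⟨a, ha0, ha⟩ := eventually_arm_const (P := P) (A := A) (proposal := (proposal · ω)) hne
    refine hnot (hω.2 (tendsto_sum_atTop_of_eventually_ge
      (c := A.successProb P.qInit a.log / (max A.maxArms 2 : ℕ)) ?_ ?_))
    · exact div_pos (A.successProb _ _).2.1 (by positivity)
    · filter_upwards [ha] with t ht
      rw [(hval t).drawLaw_real (State.propose_arms P A _ _ ht) MeasurableSet.univ, hcond, mul_one,
        State.armProb, ha0, (hval t).pos_zero]
      exact div_le_div_of_nonneg_left (A.successProb _ _).2.1.le (hval t).sum_armProb_pos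
        (hval t).sum_armProb_le
  refine hωB.2 ?_
  -- Infinitely many picks force the sum of picking probabilities to diverge, even if these tend to
  -- zero.
  have h := (hω.1 hpick).atTop_mul_const hpos
  refine h.congr fun n => ?_
  rw [Finset.sum_mul]
  exact Finset.sum_congr rfl fun t _ => (hscale t).symm

/-- If almost surely `p n` holds for all large `n`, the (outer) probability of `p n` tends to
`1`. -/
theorem tendsto_measure_of_ae_eventually {Ω : Type*} {mΩ : MeasurableSpace Ω} (μ : Measure Ω)
    [IsProbabilityMeasure μ] {p : ℕ → Ω → Prop} (h : ∀ᵐ ω ∂μ, ∀ᶠ n in atTop, p n ω) :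
    Tendsto (fun n => μ {ω | p n ω}) atTop (𝓝 1) := by
  have hmono : Monotone fun n => {ω | ∀ m ≥ n, p m ω} :=
    fun a b hab ω hω m hm => hω m (hab.trans hm)
  have hunion : μ (⋃ n, {ω | ∀ m ≥ n, p m ω}) = 1 := by
    rw [← measure_univ (μ := μ)]
    refine measure_congr (eventuallyEq_univ.2 ?_)
    filter_upwards [h] with ω hω
    obtain ⟨n, hn⟩ := eventually_atTop.1 hω
    exact Set.mem_iUnion.2 ⟨n, hn⟩
  -- Continuity along increasing unions needs no measurability of the sets.
  have hlim := tendsto_measure_iUnion_atTop (μ := μ) hmono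
  rw [hunion] at hlim
  exact tendsto_of_tendsto_of_tendsto_of_le_of_le hlim tendsto_const_nhds
    (fun n => measure_mono fun ω hω => hω n le_rfl) fun n => prob_le_one

/-- Points on a path whose consecutive distances are small. -/
theorem exists_chain {E : Type*} [PseudoMetricSpace E] {a b : E} (γ : Path a b) {r : ℝ}
    (hr : 0 < r) : ∃ (n : ℕ) (x : ℕ → E), x 0 = a ∧ x n = b ∧
      (∀ j < n, dist (x j) (x (j + 1)) ≤ r) ∧ ∀ j, ∃ τ, x j = γ τ := by
  obtain ⟨e, he, hγ⟩ := Metric.uniformContinuous_iff.1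
    (CompactSpace.uniformContinuous_of_continuous γ.continuous) r hr
  obtain ⟨n, hn⟩ := exists_nat_one_div_lt he
  have hn0 : (0 : ℝ) < n + 1 := by positivity
  refine ⟨n + 1, fun j => γ (Set.projIcc 0 1 zero_le_one ((j : ℝ) / (n + 1))), ?_, ?_, ?_,
    fun j => ⟨_, rfl⟩⟩
  · simp
  · have : ((n + 1 : ℕ) : ℝ) / (n + 1) = 1 := by push_cast; exact div_self hn0.ne'
    simp only [this, Set.projIcc_right]
    exact γ.target
  · intro j _
    refine (hγ ?_).le
    refine lt_of_le_of_lt ?_ hn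
    refine ((LipschitzWith.projIcc (zero_le_one (α := ℝ))).dist_le_mul _ _).trans ?_
    rw [Real.dist_eq, NNReal.coe_one, one_mul, ← sub_div, abs_div, abs_of_pos hn0]
    simp

/-- Finite volume matters: otherwise the normalising factor, and with it the measure, would be zero.
-/
theorem cond_real_closedBall_pos {d : ℕ} {S : Set (Config d)} (hS : MeasurableSet S)
    (hvol : (volume : Measure (Config d)) S ≠ ⊤) {x : Config d} {r : ℝ} (hr : 0 < r)
    (hsub : Metric.closedBall x r ⊆ S) :
    0 < (ProbabilityTheory.cond volume S).real (Metric.closedBall x r) := by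
  rw [measureReal_def, ProbabilityTheory.cond_apply hS, Set.inter_eq_self_of_subset_right hsub]
  have h1 : 0 < (volume : Measure (Config d)) (Metric.closedBall x r) :=
    Metric.measure_closedBall_pos _ x hr
  have h2 := measure_mono (μ := (volume : Measure (Config d))) hsub
  exact ENNReal.toReal_pos (mul_ne_zero (ENNReal.inv_ne_zero.2 hvol) h1.ne')
    (ENNReal.mul_ne_top (ENNReal.inv_ne_top.2 (h1.trans_le h2).ne')
      (ne_top_of_le_ne_top hvol h2))

end RRF

theorem mainTheorem2 {d : ℕ} (hd : 2 ≤ d) (P : RRF.Problem d) (A : RRF.Params d)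
    (hvol : MeasureTheory.volume P.free ≠ ⊤) (hP : P.RobustlyFeasible)
    {Ω : Type*} {mΩ : MeasurableSpace Ω} (μ : MeasureTheory.Measure Ω)
    [MeasureTheory.IsProbabilityMeasure μ] (ℱ : MeasureTheory.Filtration ℕ mΩ)
    (proposal : ℕ → Ω → RRF.Config d × ℝ) (draw : ℕ → Ω → ℕ × RRF.Config d)
    (hrun : RRF.IsRun P A μ ℱ proposal draw) :
    Filter.Tendsto
        (fun i : ℕ => μ {ω | (RRF.stateAt P A (proposal · ω) (draw · ω) i).Solved P})
        Filter.atTop (nhds 1) ∧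
      Filter.Tendsto
        (fun N : ℕ => μ {ω | ∃ i, RRF.StopsAt P A (proposal · ω) (draw · ω) N i ∧
          (RRF.stateAt P A (proposal · ω) (draw · ω) i).Solved P})
        Filter.atTop (nhds 1) := by
  obtain ⟨δ, hδ, γ, hγ⟩ := hP
  -- `3 * r` bounds the distance from a covering vertex to a sample in the next ball; `4 * r` is the
  -- radius of the ball containing the connecting segment.
  obtain ⟨r, hr, hrε, hrδ⟩ : ∃ r : ℝ, 0 < r ∧ 3 * r ≤ A.ε ∧ 4 * r ≤ δ := by
    refine ⟨min (A.ε / 3) (δ / 4), lt_min (by linarith [A.ε_pos]) (by linarith), ?_, ?_⟩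
    · linarith [min_le_left (A.ε / 3) (δ / 4)]
    · linarith [min_le_right (A.ε / 3) (δ / 4)]
  obtain ⟨n, x, hx0, hxn, hx, hxγ⟩ := RRF.exists_chain γ hr
  have hfree : ∀ j, Metric.closedBall (x j) (4 * r) ⊆ P.free := fun j => by
    obtain ⟨τ, hτ⟩ := hxγ j
    exact (Metric.closedBall_subset_closedBall hrδ).trans (hτ ▸ hγ τ)
  have hae : ∀ᵐ ω ∂μ, ∀ j, ∃ᶠ t in Filter.atTop,
      draw t ω ∈ ({0} : Set ℕ) ×ˢ Metric.closedBall (x j) r :=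
    MeasureTheory.ae_all_iff.2 fun j =>
      hrun.ae_frequently_mem Metric.isClosed_closedBall.measurableSet
      (RRF.cond_real_closedBall_pos isClosed_closure.measurableSet hvol hr
        ((Metric.closedBall_subset_closedBall (by linarith)).trans (hfree j)))
  have hgrow := hae.mono fun ω hω => RRF.eventually_solved_of_frequently (P := P) (A := A)
    (proposal := (proposal · ω)) (draw := (draw · ω)) hr.le hrε hx0 hxn hx (fun j _ => hfree j)
    fun j _ => hω j
  exact ⟨RRF.tendsto_measure_of_ae_eventually μ (hgrow.mono fun ω hω => hω.1),
    RRF.tendsto_measure_of_ae_eventually μ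
      (hgrow.mono fun ω hω => RRF.eventually_stopsAt_solved hω.1 hω.2)⟩
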